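/- For a ring $R$ (associative with identity), let $\mathrm{M}_\infty(R)$ denote the (nonunital) ring of countably infinite square matrices $(r_{ij})_{i,j\in\mathbb{N}}$ over $R$ having at most finitely many nonzero entries, with the usual matrix addition and multiplication. Two unital rings are called Morita equivalent if their categories of right modules are equivalent. Let $A$ and $B$ be unital rings. Then $\mathrm{M}_\infty(A)\cong \mathrm{M}_\infty(B)$ as rings if and only if $A$ and $B$ are Morita equivalent. -/

import Mathlib

universe u v

/-- The additive group of countably infinite square matrices over `R` (indexed by `ℕ × ℕ`)
with at most finitely many nonzero entries. -/
def finMatrixAddSubgroup (R : Type*) [Ring R] : AddSubgroup (Matrix ℕ ℕ R) where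
  carrier := {M | {p : ℕ × ℕ | M p.1 p.2 ≠ 0}.Finite}
  zero_mem' := by simp
  add_mem' := by
    intro M N hM hN
    refine (hM.union hN).subset ?_
    intro p hp
    simp only [Set.mem_ofPred_eq, Set.mem_union, Matrix.add_apply] at hp ⊢
    by_contra! h
    exact hp (by rw [h.1, h.2, add_zero])
  neg_mem' := by
    intro M hM
    simpa using hM

/-- `MInf R` is `M_∞(R)`: the countably infinite square matrices over `R` with at most finitely
many nonzero entries. Addition is entrywise. -/
def MInf (R : Type*) [Ring R] : Type _ := finMatrixAddSubgroup R

namespace MInf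

instance instAddCommGroup (R : Type*) [Ring R] : AddCommGroup (MInf R) :=
  inferInstanceAs (AddCommGroup (finMatrixAddSubgroup R))

/-- The `(i, j)` entry of a matrix in `M_∞(R)`. -/
def entry {R : Type*} [Ring R] (M : MInf R) (i j : ℕ) : R := M.1 i j

theorem ext {R : Type*} [Ring R] {M N : MInf R} (h : ∀ i j, M.entry i j = N.entry i j) :
    M = N :=
  Subtype.ext (funext fun i => funext fun j => h i j)

theorem finite_support {R : Type*} [Ring R] (M : MInf R) :
    {p : ℕ × ℕ | M.entry p.1 p.2 ≠ 0}.Finite := M.2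

theorem entry_add {R : Type*} [Ring R] (M N : MInf R) (i j : ℕ) :
    (M + N).entry i j = M.entry i j + N.entry i j := rfl

theorem entry_zero {R : Type*} [Ring R] (i j : ℕ) : (0 : MInf R).entry i j = 0 := rfl

/-- Every matrix in `M_∞(R)` is supported in a finite upper left corner. -/
theorem exists_bound {R : Type*} [Ring R] (M : MInf R) :
    ∃ n : ℕ, ∀ i j, n ≤ i ∨ n ≤ j → M.entry i j = 0 := by
  obtain ⟨a, ha⟩ := (M.finite_support.image Prod.fst).bddAbove
  obtain ⟨b, hb⟩ := (M.finite_support.image Prod.snd).bddAbove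
  refine ⟨max a b + 1, fun i j hij => ?_⟩
  by_contra h
  have h1 : i ≤ a := ha ⟨(i, j), h, rfl⟩
  have h2 : j ≤ b := hb ⟨(i, j), h, rfl⟩
  omega

/-- Matrix multiplication: `(M N)_{i k} = ∑_j M_{i j} N_{j k}`, a sum with finitely many nonzero
terms. -/
noncomputable instance instMul (R : Type*) [Ring R] : Mul (MInf R) where
  mul M N := ⟨fun i k => ∑ᶠ j : ℕ, M.entry i j * N.entry j k, by
    obtain ⟨m, hm⟩ := M.exists_bound
    obtain ⟨n, hn⟩ := N.exists_bound
    refine ((Set.finite_Iio m).prod (Set.finite_Iio n)).subset ?_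
    rintro ⟨i, k⟩ h
    by_contra hik
    apply h
    rw [Set.mem_prod, Set.mem_Iio, Set.mem_Iio, not_and_or, not_lt, not_lt] at hik
    refine finsum_eq_zero_of_forall_eq_zero fun j => ?_
    rcases hik with hi | hk
    · rw [hm i j (Or.inl hi), zero_mul]
    · rw [hn j k (Or.inr hk), mul_zero]⟩

theorem entry_mul {R : Type*} [Ring R] (M N : MInf R) (i k : ℕ) :
    (M * N).entry i k = ∑ᶠ j : ℕ, M.entry i j * N.entry j k := rfl

theorem entry_mul_of_left {R : Type*} [Ring R] (M N : MInf R) {n : ℕ}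
    (h : ∀ i j, n ≤ i ∨ n ≤ j → M.entry i j = 0) (i k : ℕ) :
    (M * N).entry i k = ∑ j ∈ Finset.range n, M.entry i j * N.entry j k := by
  rw [entry_mul]
  refine finsum_eq_sum_of_support_subset _ fun j hj => ?_
  by_contra hn
  rw [Finset.mem_coe, Finset.mem_range, not_lt] at hn
  exact hj (by simp only [h i j (Or.inr hn), zero_mul])

theorem entry_mul_of_right {R : Type*} [Ring R] (M N : MInf R) {n : ℕ}
    (h : ∀ i j, n ≤ i ∨ n ≤ j → N.entry i j = 0) (i k : ℕ) :
    (M * N).entry i k = ∑ j ∈ Finset.range n, M.entry i j * N.entry j k := by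
  rw [entry_mul]
  refine finsum_eq_sum_of_support_subset _ fun j hj => ?_
  by_contra hn
  rw [Finset.mem_coe, Finset.mem_range, not_lt] at hn
  exact hj (by simp only [h j k (Or.inl hn), mul_zero])

/-- `M_∞(R)` is a (nonunital, associative) ring. -/
noncomputable instance instNonUnitalRing (R : Type*) [Ring R] : NonUnitalRing (MInf R) :=
  { instAddCommGroup R, instMul R with
    left_distrib := by
      intro M N P
      obtain ⟨m, hm⟩ := M.exists_bound
      refine ext fun i k => ?_
      rw [entry_add, entry_mul_of_left M _ hm, entry_mul_of_left M _ hm,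
        entry_mul_of_left M _ hm, ← Finset.sum_add_distrib]
      exact Finset.sum_congr rfl fun j _ => by rw [entry_add, mul_add]
    right_distrib := by
      intro M N P
      obtain ⟨p, hp⟩ := P.exists_bound
      refine ext fun i k => ?_
      rw [entry_add, entry_mul_of_right _ P hp, entry_mul_of_right _ P hp,
        entry_mul_of_right _ P hp, ← Finset.sum_add_distrib]
      exact Finset.sum_congr rfl fun j _ => by rw [entry_add, add_mul]
    zero_mul := by
      intro M
      refine ext fun i k => ?_
      rw [entry_mul, entry_zero]
      exact finsum_eq_zero_of_forall_eq_zero fun j => by rw [entry_zero, zero_mul]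
    mul_zero := by
      intro M
      refine ext fun i k => ?_
      rw [entry_mul, entry_zero]
      exact finsum_eq_zero_of_forall_eq_zero fun j => by rw [entry_zero, mul_zero]
    mul_assoc := by
      intro M N P
      obtain ⟨m, hm⟩ := M.exists_bound
      obtain ⟨p, hp⟩ := P.exists_bound
      refine ext fun i k => ?_
      rw [entry_mul_of_right _ P hp, entry_mul_of_left M _ hm]
      simp only [entry_mul_of_left M N hm, entry_mul_of_right N P hp, Finset.sum_mul,
        Finset.mul_sum, mul_assoc]
      exact Finset.sum_comm }

end MInf

/-- Two unital rings are Morita equivalent if their categories of right modules are equivalent.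
A right `R`-module is a left module over the opposite ring `Rᵐᵒᵖ`. -/
def MoritaEquivalent (A : Type u) (B : Type v) [Ring A] [Ring B] : Prop :=
  Nonempty (CategoryTheory.Equivalence
    (ModuleCat.{max u v} Aᵐᵒᵖ) (ModuleCat.{max u v} Bᵐᵒᵖ))

/-! Write X^∞ for a countable direct sum of copies of X. The ring M_∞(End X) consists of the
endomorphisms of X^∞ that vanish on all but finitely many summands and have image in finitely many
summands (`toMInf_bijective`). A linear isomorphism X^∞ ≅ Y^∞ need not respect this finiteness; one
that is controlled in both directions does.

From Morita equivalence to matrices: an equivalence E carries the regular module A to a B-module X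
with endomorphism ring A. Since E preserves separators, X and the regular module B are each a direct
summand of a finite power of the other (`exists_sum_eq_id_of_isSeparator`). Then X^∞ ≅ B^∞ ⊕ X^∞ ≅
B^∞ by a swindle (`iso_of_sum_eq`), and all isomorphisms involved are controlled.

From matrices to Morita equivalence: for a right A-module V, the finitely supported rows over V form
a right M_∞(A)-module. If φ is a ring isomorphism and e = φ⁻¹(e₀₀), then the rows fixed by e form a
right B-module, functorially in V. The matrix units of M_∞(B) identify the rows over V with the rows
over this corner, compatibly with φ (`toRow_act`, `ofRow_toRow`, `toRow_ofRow`). Cutting with e₀₀ in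
M_∞(A) recovers V, so the two corner functors are mutually inverse. -/

/-! ### Bifiltered modules and controlled maps -/

/-- A module with a decreasing sequence of submodules `tail n` and an increasing sequence of
submodules `head n`. -/
structure Bifiltration (R M : Type*) [Ring R] [AddCommGroup M] [Module R M] where
  /-- The decreasing filtration. -/
  tail : ℕ → Submodule R M
  /-- The increasing filtration. -/
  head : ℕ → Submodule R M
  tail_anti : Antitone tail
  head_mono : Monotone head

namespace Bifiltration

section

variable {R M N K : Type*} [Ring R] [AddCommGroup M] [Module R M] [AddCommGroup N] [Module R N]
  [AddCommGroup K] [Module R K]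

/-- A linear map is controlled if it is continuous for the decreasing filtrations and bounded for
the increasing ones. -/
def Controlled (F : Bifiltration R M) (G : Bifiltration R N) (f : M →ₗ[R] N) : Prop :=
  (∀ n, ∃ m, ∀ v ∈ F.tail m, f v ∈ G.tail n) ∧ ∀ n, ∃ m, ∀ v ∈ F.head n, f v ∈ G.head m

theorem Controlled.comp {F : Bifiltration R M} {G : Bifiltration R N} {H : Bifiltration R K}
    {g : N →ₗ[R] K} {f : M →ₗ[R] N} (hg : Controlled G H g) (hf : Controlled F G f) :
    Controlled F H (g ∘ₗ f) := by
  refine ⟨fun n => ?_, fun n => ?_⟩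
  · obtain ⟨m, hm⟩ := hg.1 n
    obtain ⟨k, hk⟩ := hf.1 m
    exact ⟨k, fun v hv => hm _ (hk v hv)⟩
  · obtain ⟨m, hm⟩ := hf.2 n
    obtain ⟨k, hk⟩ := hg.2 m
    exact ⟨k, fun v hv => hk _ (hm v hv)⟩

/-- Two bifiltered modules are isomorphic if there is a linear equivalence between them that is
controlled in both directions. -/
def Iso (F : Bifiltration R M) (G : Bifiltration R N) : Prop :=
  ∃ e : M ≃ₗ[R] N, Controlled F G e ∧ Controlled G F e.symm

theorem Iso.symm {F : Bifiltration R M} {G : Bifiltration R N} (h : Iso F G) : Iso G F := by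
  obtain ⟨e, h1, h2⟩ := h
  exact ⟨e.symm, h2, by simpa using h1⟩

theorem Iso.trans {F : Bifiltration R M} {G : Bifiltration R N} {H : Bifiltration R K}
    (h : Iso F G) (h' : Iso G H) : Iso F H := by
  obtain ⟨e, h1, h2⟩ := h
  obtain ⟨e', h1', h2'⟩ := h'
  exact ⟨e.trans e', h1'.comp h1, h2.comp h2'⟩

/-- The product of two bifiltered modules. -/
def prod (F : Bifiltration R M) (G : Bifiltration R N) : Bifiltration R (M × N) where
  tail n := (F.tail n).prod (G.tail n)
  head n := (F.head n).prod (G.head n)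
  tail_anti _ _ h := Submodule.prod_mono (F.tail_anti h) (G.tail_anti h)
  head_mono _ _ h := Submodule.prod_mono (F.head_mono h) (G.head_mono h)

theorem Controlled.prod_fst (F : Bifiltration R M) (G : Bifiltration R N) :
    Controlled (F.prod G) F (LinearMap.fst R M N) :=
  ⟨fun n => ⟨n, fun _ hv => hv.1⟩, fun n => ⟨n, fun _ hv => hv.1⟩⟩

theorem Controlled.prod_snd (F : Bifiltration R M) (G : Bifiltration R N) :
    Controlled (F.prod G) G (LinearMap.snd R M N) :=
  ⟨fun n => ⟨n, fun _ hv => hv.2⟩, fun n => ⟨n, fun _ hv => hv.2⟩⟩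

theorem Controlled.prod {F : Bifiltration R M} {G : Bifiltration R N} {H : Bifiltration R K}
    {f : M →ₗ[R] N} {g : M →ₗ[R] K} (hf : Controlled F G f) (hg : Controlled F H g) :
    Controlled F (G.prod H) (f.prod g) := by
  refine ⟨fun n => ?_, fun n => ?_⟩
  · obtain ⟨a, ha⟩ := hf.1 n
    obtain ⟨b, hb⟩ := hg.1 n
    exact ⟨max a b, fun v hv => ⟨ha v (F.tail_anti (le_max_left a b) hv),
      hb v (F.tail_anti (le_max_right a b) hv)⟩⟩
  · obtain ⟨a, ha⟩ := hf.2 n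
    obtain ⟨b, hb⟩ := hg.2 n
    exact ⟨max a b, fun v hv => ⟨G.head_mono (le_max_left a b) (ha v hv),
      H.head_mono (le_max_right a b) (hb v hv)⟩⟩

theorem Controlled.add {F : Bifiltration R M} {G : Bifiltration R N}
    {f g : M →ₗ[R] N} (hf : Controlled F G f) (hg : Controlled F G g) :
    Controlled F G (f + g) := by
  refine ⟨fun n => ?_, fun n => ?_⟩
  · obtain ⟨a, ha⟩ := hf.1 n
    obtain ⟨b, hb⟩ := hg.1 n
    exact ⟨max a b, fun v hv => add_mem (ha v (F.tail_anti (le_max_left a b) hv))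
      (hb v (F.tail_anti (le_max_right a b) hv))⟩
  · obtain ⟨a, ha⟩ := hf.2 n
    obtain ⟨b, hb⟩ := hg.2 n
    exact ⟨max a b, fun v hv => add_mem (G.head_mono (le_max_left a b) (ha v hv))
      (G.head_mono (le_max_right a b) (hb v hv))⟩

theorem Iso.prod_comm (F : Bifiltration R M) (G : Bifiltration R N) :
    Iso (F.prod G) (G.prod F) :=
  ⟨LinearEquiv.prodComm R M N, (Controlled.prod_snd F G).prod (Controlled.prod_fst F G),
    (Controlled.prod_snd G F).prod (Controlled.prod_fst G F)⟩

/-- The ring of endomorphisms that vanish on some `tail n` and have image in some `head n`. -/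
def finEnd (F : Bifiltration R M) : NonUnitalSubring (Module.End R M) where
  carrier := {f | ∃ n, (∀ v ∈ F.tail n, f v = 0) ∧ ∀ v, f v ∈ F.head n}
  zero_mem' := ⟨0, by simp⟩
  add_mem' := by
    rintro f g ⟨a, ha, ha'⟩ ⟨b, hb, hb'⟩
    refine ⟨max a b, fun v hv => ?_, fun v => ?_⟩
    · rw [LinearMap.add_apply, ha v (F.tail_anti (le_max_left a b) hv),
        hb v (F.tail_anti (le_max_right a b) hv), add_zero]
    · exact add_mem (F.head_mono (le_max_left a b) (ha' v))
        (F.head_mono (le_max_right a b) (hb' v))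
  neg_mem' := by
    rintro f ⟨a, ha, ha'⟩
    exact ⟨a, fun v hv => by rw [LinearMap.neg_apply, ha v hv, neg_zero],
      fun v => neg_mem (ha' v)⟩
  mul_mem' := by
    rintro f g ⟨a, ha, ha'⟩ ⟨b, hb, hb'⟩
    refine ⟨max a b, fun v hv => ?_, fun v => ?_⟩
    · rw [Module.End.mul_apply, hb v (F.tail_anti (le_max_right a b) hv), map_zero]
    · exact F.head_mono (le_max_left a b) (ha' _)

/-- Vanishing on a tail is transported by continuity of `e.symm`, having image in a head by
boundedness of `e`. -/
theorem conj_mem_finEnd {F : Bifiltration R M} {G : Bifiltration R N} {e : M ≃ₗ[R] N}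
    (h1 : Controlled F G e) (h2 : Controlled G F e.symm) {f : Module.End R M}
    (hf : f ∈ F.finEnd) : e.conjRingEquiv f ∈ G.finEnd := by
  obtain ⟨n, hn, hn'⟩ := hf
  obtain ⟨a, ha⟩ := h2.1 n
  obtain ⟨b, hb⟩ := h1.2 n
  refine ⟨max a b, fun v hv => ?_, fun v => ?_⟩
  · have : f (e.symm v) = 0 := hn _ (ha v (G.tail_anti (le_max_left a b) hv))
    change e (f (e.symm v)) = 0
    rw [this, map_zero]
  · exact G.head_mono (le_max_right a b) (hb _ (hn' _))

theorem Iso.finEnd_ringEquiv {F : Bifiltration R M} {G : Bifiltration R N} (h : Iso F G) :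
    Nonempty (F.finEnd ≃+* G.finEnd) := by
  obtain ⟨e, h1, h2⟩ := h
  exact ⟨{
    toFun := fun f => ⟨e.conjRingEquiv f.1, conj_mem_finEnd h1 h2 f.2⟩
    invFun := fun f => ⟨e.symm.conjRingEquiv f.1,
      conj_mem_finEnd h2 (by simpa using h1) f.2⟩
    left_inv := fun f => Subtype.ext (LinearMap.ext fun v => by simp)
    right_inv := fun f => Subtype.ext (LinearMap.ext fun v => by simp)
    map_mul' := fun f g => Subtype.ext (map_mul e.conjRingEquiv f.1 g.1)
    map_add' := fun f g => Subtype.ext (map_add e.conjRingEquiv f.1 g.1) }⟩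

end

/-! ### Controlled isomorphisms between countable direct sums -/

section Finsupp

variable (R : Type*) [Ring R] (X Y Z : Type*) [AddCommGroup X] [Module R X] [AddCommGroup Y]
  [Module R Y] [AddCommGroup Z] [Module R Z]

/-- The standard bifiltration on a countable direct sum of copies of a module. -/
def std : Bifiltration R (ℕ →₀ X) where
  tail n :=
    { carrier := {v | ∀ i < n, v i = 0}
      zero_mem' := fun _ _ => rfl
      add_mem' := fun hv hw i hi => by rw [Finsupp.add_apply, hv i hi, hw i hi, add_zero]
      smul_mem' := fun r v hv i hi => by rw [Finsupp.smul_apply, hv i hi, smul_zero] }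
  head n :=
    { carrier := {v | ∀ i, n ≤ i → v i = 0}
      zero_mem' := fun _ _ => rfl
      add_mem' := fun hv hw i hi => by rw [Finsupp.add_apply, hv i hi, hw i hi, add_zero]
      smul_mem' := fun r v hv i hi => by rw [Finsupp.smul_apply, hv i hi, smul_zero] }
  tail_anti _ _ h _ hv i hi := hv i (hi.trans_le h)
  head_mono _ _ h _ hv i hi := hv i (h.trans hi)

variable {R X Y Z}

theorem controlled_mapRange (f : X →ₗ[R] Y) :
    Controlled (std R X) (std R Y) (Finsupp.mapRange.linearMap f) :=
  ⟨fun n => ⟨n, fun v hv i hi => by simp [hv i hi]⟩,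
    fun n => ⟨n, fun v hv i hi => by simp [hv i hi]⟩⟩

/-- Images and preimages of an initial segment of ℕ under an injection are finite, hence bounded. -/
theorem controlled_comapDomain {s : ℕ → ℕ} (hs : Function.Injective s) :
    Controlled (std R X) (std R X) (Finsupp.lcomapDomain s hs) := by
  refine ⟨fun n => ?_, fun n => ?_⟩
  · obtain ⟨m, hm⟩ := ((Set.finite_Iio n).image s).bddAbove
    refine ⟨m + 1, fun v hv i hi => ?_⟩
    exact hv (s i) (Nat.lt_succ_of_le (hm ⟨i, hi, rfl⟩))
  · obtain ⟨m, hm⟩ := ((Set.finite_Iio n).preimage hs.injOn).bddAbove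
    refine ⟨m + 1, fun v hv i hi => hv (s i) ?_⟩
    by_contra h
    have : i ≤ m := hm (not_le.mp h)
    omega

theorem controlled_mapDomain {s : ℕ → ℕ} (hs : Function.Injective s) :
    Controlled (std R X) (std R X) (Finsupp.lmapDomain X R s) := by
  refine ⟨fun n => ?_, fun n => ?_⟩
  · obtain ⟨m, hm⟩ := ((Set.finite_Iio n).preimage hs.injOn).bddAbove
    refine ⟨m + 1, fun v hv i hi => ?_⟩
    rw [Finsupp.lmapDomain_apply]
    by_cases h : i ∈ Set.range s
    · obtain ⟨k, rfl⟩ := h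
      rw [Finsupp.mapDomain_apply hs]
      exact hv k (Nat.lt_succ_of_le (hm hi))
    · exact Finsupp.mapDomain_of_notMem_range _ _ h
  · obtain ⟨m, hm⟩ := ((Set.finite_Iio n).image s).bddAbove
    refine ⟨m + 1, fun v hv i hi => ?_⟩
    rw [Finsupp.lmapDomain_apply]
    by_cases h : i ∈ Set.range s
    · obtain ⟨k, rfl⟩ := h
      rw [Finsupp.mapDomain_apply hs]
      refine hv k ?_
      by_contra hk
      have : s k ≤ m := hm ⟨k, not_le.mp hk, rfl⟩
      omega
    · exact Finsupp.mapDomain_of_notMem_range _ _ h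

theorem two_mul_injective : Function.Injective fun k : ℕ => 2 * k :=
  fun a b h => by simpa using h

theorem two_mul_add_one_injective : Function.Injective fun k : ℕ => 2 * k + 1 :=
  fun a b h => by simpa using h

/-- If `Y` is a retract of `Z`, then a countable direct sum of copies of `Z` absorbs a countable
direct sum of copies of `Y`. -/
theorem iso_prod_of_retract {i : Y →ₗ[R] Z} {p : Z →ₗ[R] Y} (h : ∀ y, p (i y) = y) :
    Iso (std R Z) ((std R Y).prod (std R Z)) := by
  -- Hilbert's hotel: Z is the image of `i` plus the kernel of `p`, and `q` projects onto the
  -- latter. The copies of Y at even positions leave for the first factor, the copy at position 2k+1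
  -- moves to position k, and the kernel parts stay in place.
  let q : Z →ₗ[R] Z := LinearMap.id - i ∘ₗ p
  let f₁ : (ℕ →₀ Z) →ₗ[R] (ℕ →₀ Y) :=
    Finsupp.mapRange.linearMap p ∘ₗ Finsupp.lcomapDomain _ two_mul_injective
  let f₂ : (ℕ →₀ Z) →ₗ[R] (ℕ →₀ Z) :=
    Finsupp.mapRange.linearMap (i ∘ₗ p) ∘ₗ Finsupp.lcomapDomain _ two_mul_add_one_injective
      + Finsupp.mapRange.linearMap q
  let g₁ : (ℕ →₀ Y) →ₗ[R] (ℕ →₀ Z) :=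
    Finsupp.lmapDomain Z R (fun k : ℕ => 2 * k) ∘ₗ Finsupp.mapRange.linearMap i
  let g₂ : (ℕ →₀ Z) →ₗ[R] (ℕ →₀ Z) :=
    Finsupp.lmapDomain Z R (fun k : ℕ => 2 * k + 1) ∘ₗ Finsupp.mapRange.linearMap (i ∘ₗ p)
      + Finsupp.mapRange.linearMap q
  let g : (ℕ →₀ Y) × (ℕ →₀ Z) →ₗ[R] (ℕ →₀ Z) :=
    g₁ ∘ₗ LinearMap.fst R _ _ + g₂ ∘ₗ LinearMap.snd R _ _
  have hq : ∀ z, q z = z - i (p z) := fun _ => rfl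
  have hf₁ : ∀ v k, f₁ v k = p (v (2 * k)) := fun _ _ => rfl
  have hf₂ : ∀ v k, f₂ v k = i (p (v (2 * k + 1))) + q (v k) := fun _ _ => rfl
  have hg0 : ∀ w k, g w (2 * k) = i (w.1 k) + q (w.2 (2 * k)) := by
    intro w k
    have h1 : Finsupp.mapDomain (fun k : ℕ => 2 * k) (Finsupp.mapRange.linearMap i w.1) (2 * k)
        = i (w.1 k) := Finsupp.mapDomain_apply two_mul_injective _ k
    have h2 : Finsupp.mapDomain (fun k : ℕ => 2 * k + 1)
        (Finsupp.mapRange.linearMap (i ∘ₗ p) w.2) (2 * k) = 0 :=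
      Finsupp.mapDomain_of_notMem_range _ _ (by rintro ⟨a, ha⟩; dsimp only at ha; omega)
    change Finsupp.mapDomain (fun k : ℕ => 2 * k) (Finsupp.mapRange.linearMap i w.1) (2 * k)
      + (Finsupp.mapDomain (fun k : ℕ => 2 * k + 1)
        (Finsupp.mapRange.linearMap (i ∘ₗ p) w.2) (2 * k) + q (w.2 (2 * k))) = _
    rw [h1, h2, zero_add]
  have hg1 : ∀ w k, g w (2 * k + 1) = i (p (w.2 k)) + q (w.2 (2 * k + 1)) := by
    intro w k
    have h1 : Finsupp.mapDomain (fun k : ℕ => 2 * k) (Finsupp.mapRange.linearMap i w.1)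
        (2 * k + 1) = 0 :=
      Finsupp.mapDomain_of_notMem_range _ _ (by rintro ⟨a, ha⟩; dsimp only at ha; omega)
    have h2 : Finsupp.mapDomain (fun k : ℕ => 2 * k + 1)
        (Finsupp.mapRange.linearMap (i ∘ₗ p) w.2) (2 * k + 1) = i (p (w.2 k)) :=
      Finsupp.mapDomain_apply two_mul_add_one_injective _ k
    change Finsupp.mapDomain (fun k : ℕ => 2 * k) (Finsupp.mapRange.linearMap i w.1) (2 * k + 1)
      + (Finsupp.mapDomain (fun k : ℕ => 2 * k + 1)
        (Finsupp.mapRange.linearMap (i ∘ₗ p) w.2) (2 * k + 1) + q (w.2 (2 * k + 1))) = _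
    rw [h1, h2, zero_add]
  have hpq : ∀ z, p (q z) = 0 := fun z => by rw [hq, map_sub, h, sub_self]
  have hqi : ∀ y, q (i y) = 0 := fun y => by rw [hq, h, sub_self]
  have hqq : ∀ z, q (q z) = q z := fun z => by rw [hq (q z), hpq, map_zero, sub_zero]
  refine ⟨LinearEquiv.ofLinearMap (f₁.prod f₂) g ?_ ?_, ?_, ?_⟩
  · refine LinearMap.ext fun w => Prod.ext ?_ ?_
    · refine Finsupp.ext fun k => ?_
      change f₁ (g w) k = w.1 k
      rw [hf₁, hg0, map_add, hpq, h, add_zero]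
    · refine Finsupp.ext fun k => ?_
      change f₂ (g w) k = w.2 k
      have h1 : q (g w k) = q (w.2 k) := by
        obtain ⟨l, rfl | rfl⟩ := k.even_or_odd'
        · rw [hg0, map_add, hqi, hqq, zero_add]
        · rw [hg1, map_add, hqi, hqq, zero_add]
      rw [hf₂, h1, hg1, map_add, hpq, h, add_zero, hq]
      abel
  · refine LinearMap.ext fun v => Finsupp.ext fun k => ?_
    change g (f₁ v, f₂ v) k = v k
    have h1 : ∀ l, q (f₂ v l) = q (v l) := fun l => by rw [hf₂, map_add, hqi, hqq, zero_add]
    obtain ⟨l, rfl | rfl⟩ := k.even_or_odd'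
    · rw [hg0, h1, hf₁, hq]
      abel
    · rw [hg1, h1, hf₂, map_add, hpq, h, add_zero, hq]
      abel
  · exact ((controlled_mapRange p).comp (controlled_comapDomain _)).prod
      (((controlled_mapRange _).comp (controlled_comapDomain _)).add (controlled_mapRange _))
  · exact (((controlled_mapDomain two_mul_injective).comp (controlled_mapRange i)).comp
      (Controlled.prod_fst _ _)).add ((((controlled_mapDomain two_mul_add_one_injective).comp
      (controlled_mapRange _)).add (controlled_mapRange _)).comp (Controlled.prod_snd _ _))

/-- A countable direct sum of copies of `X ^ κ`, with `κ` finite and nonempty, is a countable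
direct sum of copies of `X`. -/
theorem iso_std_finsupp (κ : Type) [Finite κ] [Nonempty κ] :
    Iso (std R X) (std R (κ →₀ X)) := by
  -- Any bijection will do: as κ is finite, only finitely many pairs have first coordinate below n,
  -- which gives all the bounds.
  obtain ⟨s⟩ : Nonempty (ℕ ≃ ℕ × κ) := nonempty_equiv_of_countable
  let e : (ℕ →₀ X) ≃ₗ[R] (ℕ →₀ κ →₀ X) :=
    (Finsupp.domLCongr s).trans (Finsupp.curryLinearEquiv R)
  have he : ∀ v i k, e v i k = v (s.symm (i, k)) := fun _ _ _ => rfl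
  have he' : ∀ v j, e.symm v j = v (s j).1 (s j).2 := by
    intro v j
    conv_rhs => rw [← e.apply_symm_apply v]
    rw [he]
    simp
  have hfin : ∀ n, {p : ℕ × κ | p.1 < n}.Finite := fun n =>
    ((Set.finite_Iio n).prod (Set.finite_univ (α := κ))).subset fun p hp => ⟨hp, trivial⟩
  have h1 : ∀ n, ∃ m, ∀ p : ℕ × κ, p.1 < n → s.symm p < m := by
    intro n
    obtain ⟨m, hm⟩ := ((hfin n).image s.symm).bddAbove
    exact ⟨m + 1, fun p hp => Nat.lt_succ_of_le (hm ⟨p, hp, rfl⟩)⟩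
  have h2 : ∀ n, ∃ m, ∀ j < n, (s j).1 < m := by
    intro n
    obtain ⟨m, hm⟩ := ((Set.finite_Iio n).image fun j => (s j).1).bddAbove
    exact ⟨m + 1, fun j hj => Nat.lt_succ_of_le (hm ⟨j, hj, rfl⟩)⟩
  refine ⟨e, ⟨fun n => ?_, fun n => ?_⟩, ⟨fun n => ?_, fun n => ?_⟩⟩
  · obtain ⟨m, hm⟩ := h1 n
    exact ⟨m, fun v hv i hi => Finsupp.ext fun k => hv _ (hm (i, k) hi)⟩
  · obtain ⟨m, hm⟩ := h2 n
    refine ⟨m, fun v hv i hi => Finsupp.ext fun k => hv _ ?_⟩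
    by_contra hlt
    have := hm _ (not_le.mp hlt)
    rw [Equiv.apply_symm_apply] at this
    exact absurd hi (not_le.mpr this)
  · obtain ⟨m, hm⟩ := h2 n
    refine ⟨m, fun v hv i hi => ?_⟩
    change e.symm v i = 0
    rw [he', hv _ (hm i hi), Finsupp.zero_apply]
  · obtain ⟨m, hm⟩ := h1 n
    refine ⟨m, fun v hv i hi => ?_⟩
    change e.symm v i = 0
    rw [he', hv, Finsupp.zero_apply]
    by_contra hlt
    have := hm _ (not_le.mp hlt)
    rw [Equiv.symm_apply_apply] at this
    exact absurd hi (not_le.mpr this)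

/-- If the identity of `Y` is a finite sum of maps that factor through `X`, then a countable direct
sum of copies of `X` absorbs a countable direct sum of copies of `Y`. -/
theorem iso_prod_of_sum_eq {n : ℕ} (i : Fin n → Y →ₗ[R] X) (p : Fin n → X →ₗ[R] Y)
    (h : ∑ k, p k ∘ₗ i k = LinearMap.id) : Iso (std R X) ((std R Y).prod (std R X)) := by
  -- Y is a retract of a finite power of X. The extra index `none` carries the zero map and keeps
  -- the index type nonempty when n = 0.
  let i' : Y →ₗ[R] (Option (Fin n) →₀ X) := ∑ k, Finsupp.lsingle (some k) ∘ₗ i k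
  let p' : (Option (Fin n) →₀ X) →ₗ[R] Y :=
    Finsupp.lsum ℕ fun o : Option (Fin n) => o.elim 0 p
  have hr : ∀ y, p' (i' y) = y := by
    intro y
    have h1 := LinearMap.congr_fun h y
    simp only [LinearMap.sum_apply, LinearMap.comp_apply, LinearMap.id_apply] at h1
    simp only [i', p', LinearMap.sum_apply, LinearMap.comp_apply, map_sum, Finsupp.lsingle_apply,
      Finsupp.lsum_single, Option.elim_some]
    exact h1
  have h1 := iso_std_finsupp (R := R) (X := X) (Option (Fin n))
  have h2 := iso_prod_of_retract hr
  obtain ⟨e, he, he'⟩ := h1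
  refine (Iso.trans ⟨e, he, he'⟩ h2).trans ⟨(LinearEquiv.refl R _).prodCongr e.symm, ?_, ?_⟩
  · exact (Controlled.prod_fst _ _).prod (he'.comp (Controlled.prod_snd _ _))
  · exact (Controlled.prod_fst _ _).prod (he.comp (Controlled.prod_snd _ _))

/-- Each of X^∞ and Y^∞ absorbs the other, so both are isomorphic to X^∞ ⊕ Y^∞. -/
theorem iso_of_sum_eq {n m : ℕ} (i : Fin n → Y →ₗ[R] X) (p : Fin n → X →ₗ[R] Y)
    (h : ∑ k, p k ∘ₗ i k = LinearMap.id) (i' : Fin m → X →ₗ[R] Y) (p' : Fin m → Y →ₗ[R] X)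
    (h' : ∑ k, p' k ∘ₗ i' k = LinearMap.id) : Iso (std R X) (std R Y) :=
  ((iso_prod_of_sum_eq i p h).trans (Iso.prod_comm _ _)).trans (iso_prod_of_sum_eq i' p' h').symm

/-! ### Finite endomorphisms as finite matrices -/

/-- The block of an endomorphism of a countable direct sum at position `(i, j)`. -/
noncomputable def block (f : Module.End R (ℕ →₀ X)) (i j : ℕ) : Module.End R X :=
  Finsupp.lapply i ∘ₗ f ∘ₗ Finsupp.lsingle j

theorem block_apply (f : Module.End R (ℕ →₀ X)) (i j : ℕ) (x : X) :
    block f i j x = f (Finsupp.single j x) i := rfl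

theorem exists_block_eq_zero {f : Module.End R (ℕ →₀ X)} (hf : f ∈ (std R X).finEnd) :
    ∃ n, ∀ i j, n ≤ i ∨ n ≤ j → block f i j = 0 := by
  obtain ⟨n, hn, hn'⟩ := hf
  refine ⟨n, fun i j hij => LinearMap.ext fun x => ?_⟩
  rw [block_apply]
  rcases hij with hi | hj
  · exact hn' _ i hi
  · rw [hn (Finsupp.single j x) fun k hk => Finsupp.single_eq_of_ne (by omega)]
    rfl

theorem eq_sum_single_of_mem_head {n : ℕ} {v : ℕ →₀ X} (hv : v ∈ (std R X).head n) :
    v = ∑ k ∈ Finset.range n, Finsupp.single k (v k) := by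
  ext i
  rw [Finsupp.finsetSum_apply]
  by_cases hi : i < n
  · rw [Finset.sum_eq_single_of_mem i (Finset.mem_range.mpr hi)
      fun k _ hk => Finsupp.single_eq_of_ne hk.symm, Finsupp.single_eq_same]
  · rw [hv i (not_lt.mp hi), Finset.sum_eq_zero fun k hk => Finsupp.single_eq_of_ne ?_]
    have := Finset.mem_range.mp hk
    omega

/-- The matrix of blocks of an endomorphism in `finEnd`. -/
noncomputable def blockMatrix {A : Type*} [Ring A] (ρ : A ≃+* Module.End R X)
    (f : (std R X).finEnd) : MInf A :=
  ⟨fun i j => ρ.symm (block f.1 i j), by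
    obtain ⟨n, hn⟩ := exists_block_eq_zero f.2
    refine ((Set.finite_Iio n).prod (Set.finite_Iio n)).subset ?_
    rintro ⟨i, k⟩ h
    by_contra hik
    rw [Set.mem_prod, Set.mem_Iio, Set.mem_Iio, not_and_or, not_lt, not_lt] at hik
    refine h ?_
    change ρ.symm (block f.1 i k) = 0
    rw [hn i k hik, map_zero]⟩

theorem blockMatrix_entry {A : Type*} [Ring A] (ρ : A ≃+* Module.End R X)
    (f : (std R X).finEnd) (i j : ℕ) :
    (blockMatrix ρ f).entry i j = ρ.symm (block f.1 i j) := rfl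

/-- The ring homomorphism from `finEnd` to finite matrices over the endomorphism ring. -/
noncomputable def toMInf {A : Type*} [Ring A] (ρ : A ≃+* Module.End R X) :
    (std R X).finEnd →ₙ+* MInf A where
  toFun := blockMatrix ρ
  map_zero' := MInf.ext fun i j => map_zero ρ.symm
  map_add' f g := MInf.ext fun i j => map_add ρ.symm (block f.1 i j) (block g.1 i j)
  map_mul' f g := by
    obtain ⟨n, hn⟩ := exists_block_eq_zero f.2
    obtain ⟨m, -, hm⟩ := g.2
    refine MInf.ext fun i k => ?_
    -- The common bound `max n m` makes the matrix product and the decomposition of `g (single k x)`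
    -- sums over the same range.
    have hb : ∀ i j, max n m ≤ i ∨ max n m ≤ j → block f.1 i j = 0 := fun i j hij =>
      hn i j (hij.imp (le_max_left n m).trans (le_max_left n m).trans)
    rw [MInf.entry_mul_of_left (n := max n m) (blockMatrix ρ f) _ fun i j hij => by
      rw [blockMatrix_entry, hb i j hij, map_zero]]
    simp only [blockMatrix_entry]
    simp only [← map_mul, ← map_sum]
    refine congrArg _ (LinearMap.ext fun x => ?_)
    have hw : g.1 (Finsupp.single k x) ∈ (std R X).head (max n m) :=
      (std R X).head_mono (le_max_right n m) (hm _)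
    change f.1 (g.1 (Finsupp.single k x)) i = _
    rw [eq_sum_single_of_mem_head hw, map_sum,
      Finsupp.finsetSum_apply, LinearMap.sum_apply]
    rfl

theorem toMInf_entry {A : Type*} [Ring A] (ρ : A ≃+* Module.End R X) (f : (std R X).finEnd)
    (i j : ℕ) : (toMInf ρ f).entry i j = ρ.symm (block f.1 i j) := rfl

/-- An endomorphism is determined by its blocks, and a matrix with finitely many nonzero entries is
realised by the finite sum of its entries placed as blocks. -/
theorem toMInf_bijective {A : Type*} [Ring A] (ρ : A ≃+* Module.End R X) :
    Function.Bijective (toMInf ρ) := by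
  refine ⟨fun f g h => Subtype.ext (Finsupp.lhom_ext fun j x => Finsupp.ext fun i => ?_),
    fun M => ?_⟩
  · have h1 := congrArg (fun M => MInf.entry M i j) h
    simp only [toMInf_entry, EmbeddingLike.apply_eq_iff_eq] at h1
    exact LinearMap.congr_fun h1 x
  · obtain ⟨n, hn⟩ := M.exists_bound
    let f : Module.End R (ℕ →₀ X) := ∑ i ∈ Finset.range n, ∑ j ∈ Finset.range n,
      Finsupp.lsingle i ∘ₗ ρ (M.entry i j) ∘ₗ Finsupp.lapply j
    have hf : ∀ v, f v = ∑ i ∈ Finset.range n, ∑ j ∈ Finset.range n,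
        Finsupp.single i (ρ (M.entry i j) (v j)) := fun v => by
      simp [f, LinearMap.sum_apply]
    refine ⟨⟨f, n, fun v hv => ?_, fun v i hi => ?_⟩, MInf.ext fun i j => ?_⟩
    · rw [hf]
      refine Finset.sum_eq_zero fun i _ => Finset.sum_eq_zero fun j hj => ?_
      rw [hv j (Finset.mem_range.mp hj), map_zero, Finsupp.single_zero]
    · rw [hf]
      simp only [Finsupp.finsetSum_apply]
      refine Finset.sum_eq_zero fun k hk => Finset.sum_eq_zero fun j hj =>
        Finsupp.single_eq_of_ne ?_
      have := Finset.mem_range.mp hk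
      omega
    · rw [toMInf_entry, RingEquiv.symm_apply_eq]
      refine LinearMap.ext fun x => ?_
      rw [block_apply, hf]
      simp only [Finsupp.finsetSum_apply]
      by_cases hij : i < n ∧ j < n
      · rw [Finset.sum_eq_single_of_mem i (Finset.mem_range.mpr hij.1),
          Finset.sum_eq_single_of_mem j (Finset.mem_range.mpr hij.2)]
        · simp
        · intro k _ hk
          simp [Finsupp.single_eq_of_ne hk]
        · intro k _ hk
          exact Finset.sum_eq_zero fun l _ => Finsupp.single_eq_of_ne hk.symm
      · rw [hn i j (by omega), map_zero, LinearMap.zero_apply]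
        refine Finset.sum_eq_zero fun k hk => Finset.sum_eq_zero fun l hl => ?_
        rw [Finset.mem_range] at hk hl
        by_cases hki : k = i
        · have : l ≠ j := by omega
          simp [Finsupp.single_eq_of_ne this]
        · exact Finsupp.single_eq_of_ne (Ne.symm hki)

theorem nonempty_mInf_ringEquiv {A B : Type*} [Ring A] [Ring B] (ρ : A ≃+* Module.End R X)
    (σ : B ≃+* Module.End R Y) (h : Iso (std R X) (std R Y)) : Nonempty (MInf A ≃+* MInf B) := by
  obtain ⟨e⟩ := h.finEnd_ringEquiv
  exact ⟨((RingEquiv.ofBijective _ (toMInf_bijective ρ)).symm.trans e).trans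
    (RingEquiv.ofBijective _ (toMInf_bijective σ))⟩

end Finsupp

end Bifiltration

universe w

/-! ### Separators and the regular module -/

section Generator

open CategoryTheory

/-- If `G` is a separator of the category of `R`-modules, then the identity of a module that is
free of rank one is a finite sum of maps that factor through `G`. -/
theorem exists_sum_eq_id_of_isSeparator {R : Type*} [Ring R] {G : ModuleCat.{w} R}
    (hG : IsSeparator G) (P : ModuleCat.{w} R) (e : R ≃ₗ[R] P) :
    ∃ (n : ℕ) (i : Fin n → (P ⟶ G)) (p : Fin n → (G ⟶ P)), ∑ k, i k ≫ p k = 𝟙 P := by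
  -- The trace of G in P. The quotient map by T is killed by every map from G, so it is zero and T
  -- is all of P.
  let T : Submodule R P := ⨆ g : G ⟶ P, LinearMap.range g.hom
  have hT : ModuleCat.ofHom T.mkQ = 0 := by
    refine (isSeparator_def G).mp hG _ _ fun g => ?_
    ext x
    simp only [Limits.comp_zero]
    exact (Submodule.Quotient.mk_eq_zero T).mpr
      (Submodule.mem_iSup_of_mem g (LinearMap.mem_range_self g.hom x))
  have h1 : e 1 ∈ T := by
    rw [← Submodule.Quotient.mk_eq_zero]
    exact LinearMap.congr_fun (congrArg ModuleCat.Hom.hom hT) (e 1)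
  obtain ⟨a, ha, hsum⟩ := (Submodule.mem_iSup_iff_exists_finsupp _ _).mp h1
  choose x hx using fun g : G ⟶ P => ha g
  let s := a.support.equivFin
  -- The generator `e 1` is a finite sum of values `g (x g)`; the map to G for the index g sends `e
  -- r` to `r • x g`.
  refine ⟨a.support.card,
    fun k => ModuleCat.ofHom ((LinearMap.toSpanSingleton R G (x (s.symm k))) ∘ₗ e.symm.toLinearMap),
    fun k => (s.symm k).1, ?_⟩
  ext y
  obtain ⟨r, rfl⟩ := e.surjective y
  have h2 : ∑ k, (s.symm k).1.hom (x (s.symm k)) = e 1 := by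
    rw [← hsum, Finsupp.sum, ← Finset.sum_coe_sort a.support,
      ← s.symm.sum_comp (fun g : a.support => a g.1)]
    exact Finset.sum_congr rfl fun k _ => hx _
  have h3 : e r = r • e 1 := by rw [← map_smul, smul_eq_mul, mul_one]
  simp only [ModuleCat.hom_sum, ModuleCat.hom_comp, ModuleCat.hom_ofHom, LinearMap.sum_apply,
    LinearMap.comp_apply, LinearEquiv.coe_coe, LinearEquiv.symm_apply_apply,
    LinearMap.toSpanSingleton_apply, map_smul, ← Finset.smul_sum, h2, ModuleCat.hom_id,
    LinearMap.id_apply]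
  exact h3.symm

end Generator

/-- The endomorphism ring of the regular right module. -/
noncomputable def endShrinkRingEquiv (A : Type*) [Ring A] [Small.{w} Aᵐᵒᵖ] :
    A ≃+* Module.End Aᵐᵒᵖ (Shrink.{w} Aᵐᵒᵖ) :=
  ((RingEquiv.opOp A).trans (RingEquiv.moduleEndSelf Aᵐᵒᵖ)).trans
    (Shrink.linearEquiv Aᵐᵒᵖ Aᵐᵒᵖ).symm.conjRingEquiv

open CategoryTheory in
/-- An additive fully faithful functor between module categories induces isomorphisms of
endomorphism rings. -/
noncomputable def endMapRingEquiv {R S : Type*} [Ring R] [Ring S]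
    (F : ModuleCat.{w} R ⥤ ModuleCat.{w} S) [F.Additive] (hF : F.FullyFaithful)
    (P : ModuleCat.{w} R) : Module.End R P ≃+* Module.End S (F.obj P) :=
  ((ModuleCat.endRingEquiv P).symm.trans
    { hF.mulEquivEnd P with map_add' := fun _ _ => F.map_add }).trans
    (ModuleCat.endRingEquiv (F.obj P))

open CategoryTheory Bifiltration in
theorem MoritaEquivalent.nonempty_mInf_ringEquiv {A : Type u} {B : Type v} [Ring A] [Ring B]
    (h : MoritaEquivalent A B) : Nonempty (MInf A ≃+* MInf B) := by
  obtain ⟨E⟩ := h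
  -- The categories live in universe `max u v`, hence the shrunk copies of the regular modules.
  let P : ModuleCat.{max u v} Aᵐᵒᵖ := ModuleCat.of _ (Shrink.{max u v} Aᵐᵒᵖ)
  let Q : ModuleCat.{max u v} Bᵐᵒᵖ := ModuleCat.of _ (Shrink.{max u v} Bᵐᵒᵖ)
  -- Additivity makes E a ring isomorphism on endomorphisms and lets it preserve the sum `h2`.
  have := E.functor.additive_of_preserves_binary_products
  obtain ⟨n, i, p, h1⟩ := exists_sum_eq_id_of_isSeparator
    ((ModuleCat.isSeparator Aᵐᵒᵖ).of_equivalence E) Q (Shrink.linearEquiv Bᵐᵒᵖ Bᵐᵒᵖ).symm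
  obtain ⟨m, i', p', h2⟩ := exists_sum_eq_id_of_isSeparator
    ((ModuleCat.isSeparator Bᵐᵒᵖ).of_equivalence E.symm) P (Shrink.linearEquiv Aᵐᵒᵖ Aᵐᵒᵖ).symm
  refine Bifiltration.nonempty_mInf_ringEquiv
    ((endShrinkRingEquiv.{max u v} A).trans (endMapRingEquiv E.functor E.fullyFaithfulFunctor P))
    (endShrinkRingEquiv.{max u v} B)
    (iso_of_sum_eq (fun k => (i k).hom) (fun k => (p k).hom) ?_
      -- The maps of `h2` factor through E⁻¹Q, so they are pushed forward by E and corrected by the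
      -- counit.
      (fun k => (E.functor.map (i' k) ≫ E.counit.app Q).hom)
      (fun k => (E.counitInv.app Q ≫ E.functor.map (p' k)).hom) ?_)
  · have := congrArg ModuleCat.Hom.hom h1
    simpa only [ModuleCat.hom_sum, ModuleCat.hom_comp, ModuleCat.hom_id] using this
  · have h3 : ∑ k, (E.functor.map (i' k) ≫ E.counit.app Q) ≫ E.counitInv.app Q ≫
        E.functor.map (p' k) = 𝟙 (E.functor.obj P) := by
      rw [← E.functor.map_id, ← h2, Functor.map_sum]
      refine Finset.sum_congr rfl fun k _ => ?_
      rw [Category.assoc, E.functor.map_comp]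
      congr 1
      exact (E.counitIso.app Q).hom_inv_id_assoc _
    have := congrArg ModuleCat.Hom.hom h3
    simpa only [ModuleCat.hom_sum, ModuleCat.hom_comp, ModuleCat.hom_id] using this

/-! ### Matrix units and the action on row vectors -/

namespace MInf

section

variable {A : Type*} [Ring A]

/-- The matrix with the single nonzero entry `a` at position `(i, j)`. -/
def single (i j : ℕ) (a : A) : MInf A :=
  ⟨fun k l => if k = i ∧ l = j then a else 0, by
    refine (Set.finite_singleton (i, j)).subset ?_
    rintro ⟨k, l⟩ h
    by_contra hkl
    exact h (if_neg fun hh => hkl (Prod.ext hh.1 hh.2))⟩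

theorem single_entry (i j : ℕ) (a : A) (k l : ℕ) :
    (single i j a).entry k l = if k = i ∧ l = j then a else 0 := rfl

theorem single_zero (i j : ℕ) : single i j (0 : A) = 0 :=
  ext fun k l => by rw [single_entry, ite_self, entry_zero]

theorem single_add (i j : ℕ) (a b : A) : single i j (a + b) = single i j a + single i j b :=
  ext fun k l => by
    rw [entry_add]
    simp only [single_entry]
    split_ifs <;> simp

theorem mul_single_entry (M : MInf A) (i j : ℕ) (a : A) (k l : ℕ) :
    (M * single i j a).entry k l = if l = j then M.entry k i * a else 0 := by
  rw [entry_mul, finsum_eq_single _ i fun m hm => by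
    rw [single_entry, if_neg fun h => hm h.1, mul_zero], single_entry]
  simp

theorem single_mul_single (i j l : ℕ) (a b : A) :
    single i j a * single j l b = single i l (a * b) :=
  ext fun k m => by
    rw [mul_single_entry]
    simp only [single_entry]
    split_ifs <;> simp_all

theorem single_mul_single_of_ne {j k : ℕ} (h : j ≠ k) (i l : ℕ) (a b : A) :
    single i j a * single k l b = 0 :=
  ext fun m n => by
    rw [mul_single_entry, single_entry, entry_zero]
    split_ifs <;> simp_all

/-- The matrix with `n` ones on the diagonal. -/
noncomputable def trunc (A : Type*) [Ring A] (n : ℕ) : MInf A := ∑ i ∈ Finset.range n, single i i 1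

theorem entry_sum {ι : Type*} (s : Finset ι) (M : ι → MInf A) (i j : ℕ) :
    (∑ k ∈ s, M k).entry i j = ∑ k ∈ s, (M k).entry i j := by
  classical
  induction s using Finset.induction_on with
  | empty => rfl
  | insert a s ha ih => rw [Finset.sum_insert ha, Finset.sum_insert ha, entry_add, ih]

theorem mul_trunc (M : MInf A) {n : ℕ} (hn : ∀ i j, n ≤ i ∨ n ≤ j → M.entry i j = 0) :
    M * trunc A n = M := by
  refine ext fun i j => ?_
  rw [trunc, Finset.mul_sum, entry_sum]
  simp only [mul_single_entry, mul_one, Finset.sum_ite_eq, Finset.mem_range]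
  split_ifs with h
  · rfl
  · exact (hn i j (Or.inr (not_lt.mp h))).symm

theorem mul_single_eq_zero (M : MInf A) {n : ℕ} (hn : ∀ i j, n ≤ i ∨ n ≤ j → M.entry i j = 0)
    {j : ℕ} (hj : n ≤ j) (k : ℕ) (a : A) : M * single j k a = 0 :=
  ext fun l m => by rw [mul_single_entry, hn l j (Or.inr hj), zero_mul, ite_self, entry_zero]

/-- The `j`-th column of a matrix, as a sum of matrices supported in column `0`. -/
theorem mul_single_one_eq_sum (M : MInf A) {n : ℕ}
    (hn : ∀ i j, n ≤ i ∨ n ≤ j → M.entry i j = 0) (j : ℕ) :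
    M * single j 0 1 = ∑ i ∈ Finset.range n, single i 0 1 * single 0 0 (M.entry i j) := by
  refine ext fun k l => ?_
  rw [entry_sum, mul_single_entry, mul_one]
  simp only [single_mul_single, one_mul, single_entry]
  by_cases hl : l = 0
  · simp only [hl, and_true, Finset.sum_ite_eq, Finset.mem_range, if_true]
    split_ifs with h
    · rfl
    · exact hn k j (Or.inl (not_lt.mp h))
  · simp [hl]

variable {V W : Type*} [AddCommGroup V] [Module Aᵐᵒᵖ V] [AddCommGroup W] [Module Aᵐᵒᵖ W]

/-- The right action of finite matrices on finitely supported row vectors. -/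
noncomputable def act (v : ℕ →₀ V) (M : MInf A) : ℕ →₀ V :=
  Finsupp.ofSupportFinite (fun j => v.sum fun i x => MulOpposite.op (M.entry i j) • x) (by
    obtain ⟨n, hn⟩ := M.exists_bound
    refine (Set.finite_Iio n).subset fun j hj => ?_
    by_contra h
    refine hj (Finset.sum_eq_zero fun i _ => ?_)
    dsimp only
    rw [hn i j (Or.inr (not_lt.mp h)), MulOpposite.op_zero, zero_smul])

theorem act_apply (v : ℕ →₀ V) (M : MInf A) (j : ℕ) :
    act v M j = v.sum fun i x => MulOpposite.op (M.entry i j) • x := rfl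

/-- The range of summation depends on M alone, so additivity in v can be checked termwise. -/
theorem act_apply_eq_sum (v : ℕ →₀ V) (M : MInf A) {n : ℕ}
    (hn : ∀ i j, n ≤ i ∨ n ≤ j → M.entry i j = 0) (j : ℕ) :
    act v M j = ∑ i ∈ Finset.range n, MulOpposite.op (M.entry i j) • v i := by
  classical
  rw [act_apply, Finsupp.sum_of_support_subset (s := v.support ∪ Finset.range n) _
    Finset.subset_union_left _ fun _ _ => smul_zero _]
  refine (Finset.sum_subset Finset.subset_union_right fun i _ hi => ?_).symm
  rw [hn i j (Or.inl (by simpa using hi)), MulOpposite.op_zero, zero_smul]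

theorem act_add (v : ℕ →₀ V) (M N : MInf A) : act v (M + N) = act v M + act v N := by
  ext j
  simp only [Finsupp.add_apply, act_apply, entry_add, MulOpposite.op_add, add_smul,
    Finsupp.sum_add]

theorem act_zero (v : ℕ →₀ V) : act v (0 : MInf A) = 0 := by
  ext j
  simp [act_apply, entry_zero]

theorem add_act (v w : ℕ →₀ V) (M : MInf A) : act (v + w) M = act v M + act w M := by
  obtain ⟨n, hn⟩ := M.exists_bound
  ext j
  simp only [Finsupp.add_apply, act_apply_eq_sum _ M hn, smul_add, Finset.sum_add_distrib]

theorem zero_act (M : MInf A) : act (0 : ℕ →₀ V) M = 0 := by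
  ext j
  simp [act_apply]

theorem act_sum {ι : Type*} (s : Finset ι) (v : ℕ →₀ V) (M : ι → MInf A) :
    act v (∑ k ∈ s, M k) = ∑ k ∈ s, act v (M k) :=
  map_sum (⟨⟨act v, act_zero v⟩, act_add v⟩ : MInf A →+ (ℕ →₀ V)) M s

theorem sum_act {ι : Type*} (s : Finset ι) (v : ι → ℕ →₀ V) (M : MInf A) :
    act (∑ k ∈ s, v k) M = ∑ k ∈ s, act (v k) M :=
  map_sum (⟨⟨fun v => act v M, zero_act M⟩, fun v w => add_act v w M⟩ : (ℕ →₀ V) →+ (ℕ →₀ V)) v s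

theorem act_mul (v : ℕ →₀ V) (M N : MInf A) : act v (M * N) = act (act v M) N := by
  obtain ⟨n, hn⟩ := N.exists_bound
  ext j
  rw [act_apply_eq_sum _ N hn, act_apply]
  simp only [act_apply, entry_mul_of_right M N hn, Finset.smul_sum, smul_smul,
    Finset.op_sum, Finset.sum_smul, MulOpposite.op_mul, Finsupp.sum]
  exact Finset.sum_comm

theorem act_single_apply (v : ℕ →₀ V) (i j : ℕ) (a : A) (k : ℕ) :
    act v (single i j a) k = if k = j then MulOpposite.op a • v i else 0 := by
  rw [act_apply]
  by_cases hk : k = j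
  · rw [if_pos hk, Finsupp.sum, Finset.sum_eq_single i]
    · simp [single_entry, hk]
    · intro l _ hl
      simp [single_entry, hl]
    · intro hi
      rw [Finsupp.notMem_support_iff.mp hi, smul_zero]
  · simp [single_entry, hk]

/-- The truncated identities are local units, replacing the missing identity of M_∞(A). -/
theorem exists_act_trunc (v : ℕ →₀ V) : ∃ n, act v (trunc A n) = v := by
  obtain ⟨n, hn⟩ := v.support.bddAbove
  refine ⟨n + 1, ?_⟩
  ext j
  rw [trunc, act_sum, Finsupp.finsetSum_apply]
  simp only [act_single_apply, MulOpposite.op_one, one_smul, Finset.sum_ite_eq, Finset.mem_range]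
  split_ifs with h
  · rfl
  · by_contra h0
    have := hn (Finsupp.mem_support_iff.mpr (Ne.symm h0))
    omega

theorem mapRange_act (f : V →ₗ[Aᵐᵒᵖ] W) (v : ℕ →₀ V) (M : MInf A) :
    Finsupp.mapRange.linearMap f (act v M) = act (Finsupp.mapRange.linearMap f v) M := by
  obtain ⟨n, hn⟩ := M.exists_bound
  ext j
  simp only [Finsupp.mapRange.linearMap_apply, Finsupp.mapRange_apply, act_apply_eq_sum _ M hn,
    map_sum, map_smul]

end

/-! ### The corner module of a ring isomorphism -/

section Corner

variable {A B : Type*} [Ring A] [Ring B] (φ : MInf A ≃+* MInf B)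
  (V : Type*) [AddCommGroup V] [Module Aᵐᵒᵖ V]

/-- The row vectors over `V` that are fixed by the idempotent of `M_∞(A)` that corresponds to the
first diagonal matrix unit of `M_∞(B)`. -/
def Corner : Type _ :=
  ({ carrier := {v | act v (φ.symm (single 0 0 1)) = v}
     zero_mem' := zero_act _
     add_mem' := fun {v w} (hv : act v _ = v) (hw : act w _ = w) =>
      show act (v + w) _ = v + w by rw [add_act, hv, hw]
     neg_mem' := fun {v} (hv : act v _ = v) => show act (-v) _ = -v by
      rw [eq_neg_iff_add_eq_zero]
      nth_rw 2 [← hv]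
      rw [← add_act, neg_add_cancel, zero_act] } : AddSubgroup (ℕ →₀ V))

namespace Corner

noncomputable instance : AddCommGroup (Corner φ V) := by unfold Corner; infer_instance

variable {φ V}

/-- The row vector underlying an element of the corner. -/
def val (v : Corner φ V) : ℕ →₀ V := v.1

theorem val_injective : Function.Injective (val : Corner φ V → ℕ →₀ V) := Subtype.val_injective

theorem act_val (v : Corner φ V) : act v.val (φ.symm (single 0 0 1)) = v.val := v.2

theorem val_add (v w : Corner φ V) : (v + w).val = v.val + w.val := rfl

theorem val_zero : (0 : Corner φ V).val = 0 := rfl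

/-- The element of the corner given by a row vector times an element of column `0`. -/
noncomputable def mk (v : ℕ →₀ V) (i : ℕ) (b : B) : Corner φ V :=
  ⟨act v (φ.symm (single i 0 b)), by
    change act (act _ _) _ = _
    rw [← act_mul, ← map_mul, single_mul_single, mul_one]⟩

/-- The map b ↦ φ⁻¹(b e₀₀) is additive and multiplicative, and sends 1 to the idempotent that fixes
the corner. -/
noncomputable instance : Module Bᵐᵒᵖ (Corner φ V) where
  smul b v := mk v.val 0 b.unop
  one_smul v := val_injective (act_val v)
  mul_smul b c v := val_injective <| by
    change act _ (φ.symm (single 0 0 (c.unop * b.unop))) = act (act _ _) _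
    rw [← act_mul, ← map_mul, single_mul_single]
  smul_zero b := val_injective (zero_act _)
  smul_add b v w := val_injective (add_act _ _ _)
  add_smul b c v := val_injective <| by
    change act _ (φ.symm (single 0 0 (b.unop + c.unop))) = act _ _ + act _ _
    rw [single_add, map_add, act_add]
  zero_smul v := val_injective <| by
    change act _ (φ.symm (single 0 0 0)) = 0
    rw [single_zero, map_zero, act_zero]

theorem val_smul (b : Bᵐᵒᵖ) (v : Corner φ V) :
    (b • v).val = act v.val (φ.symm (single 0 0 b.unop)) := rfl

theorem val_sum {ι : Type*} (s : Finset ι) (v : ι → Corner φ V) :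
    (∑ k ∈ s, v k).val = ∑ k ∈ s, (v k).val :=
  map_sum (⟨⟨val, val_zero⟩, val_add⟩ : Corner φ V →+ (ℕ →₀ V)) v s

variable {W : Type*} [AddCommGroup W] [Module Aᵐᵒᵖ W]

/-- The corner is functorial in the module. -/
noncomputable def map (f : V →ₗ[Aᵐᵒᵖ] W) : Corner φ V →ₗ[Bᵐᵒᵖ] Corner φ W where
  toFun v := ⟨Finsupp.mapRange.linearMap f v.val, by
    change act _ _ = _
    rw [← mapRange_act, act_val]⟩
  map_add' v w := val_injective (map_add (Finsupp.mapRange.linearMap f) v.val w.val)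
  map_smul' b v := val_injective (mapRange_act f v.val _)

/-- Local units are transported along φ: a truncated identity t of M_∞(A) fixes v, so φ⁻¹(M) acts on
v as φ⁻¹(φ(t) M), and φ(t) has finite support. -/
theorem exists_act_symm_trunc (φ : MInf A ≃+* MInf B) (v : ℕ →₀ V) :
    ∃ n, act v (φ.symm (trunc B n)) = v ∧
      ∀ j, n ≤ j → ∀ k b, act v (φ.symm (single j k b)) = 0 := by
  obtain ⟨m, hm⟩ := exists_act_trunc (A := A) v
  obtain ⟨n, hn⟩ := (φ (trunc A m)).exists_bound
  have h1 : ∀ M : MInf B, act v (φ.symm M) = act v (φ.symm (φ (trunc A m) * M)) := fun M => by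
    rw [map_mul, φ.symm_apply_apply, act_mul, hm]
  refine ⟨n, ?_, fun j hj k b => ?_⟩
  · rw [h1, mul_trunc _ hn, φ.symm_apply_apply, hm]
  · rw [h1, mul_single_eq_zero _ hn hj, map_zero, act_zero]

/-- Row vectors over `V` as row vectors over the corner. -/
noncomputable def toRow (v : ℕ →₀ V) : ℕ →₀ Corner φ V :=
  Finsupp.ofSupportFinite (fun j => mk v j 1) (by
    obtain ⟨n, -, hn⟩ := exists_act_symm_trunc φ v
    refine (Set.finite_Iio n).subset fun j hj => ?_
    by_contra h
    exact hj (val_injective (hn j (not_lt.mp h) 0 1)))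

theorem val_toRow (v : ℕ →₀ V) (j : ℕ) :
    (toRow v j : Corner φ V).val = act v (φ.symm (single j 0 1)) := rfl

theorem toRow_add (v w : ℕ →₀ V) : (toRow (v + w) : ℕ →₀ Corner φ V) = toRow v + toRow w :=
  Finsupp.ext fun _ => val_injective (add_act _ _ _)

/-- Entry j on the left is v acted on by φ⁻¹(φ(M) e_{j0}); expanding column j of φ(M) gives the
entries of a row times a matrix. -/
theorem toRow_act (v : ℕ →₀ V) (M : MInf A) :
    (toRow (act v M) : ℕ →₀ Corner φ V) = act (toRow v) (φ M) := by
  obtain ⟨n, hn⟩ := (φ M).exists_bound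
  refine Finsupp.ext fun j => val_injective ?_
  rw [act_apply_eq_sum _ _ hn, val_toRow, val_sum, ← act_mul]
  conv_lhs => rw [← φ.symm_apply_apply M, ← map_mul, mul_single_one_eq_sum _ hn, map_sum, act_sum]
  refine Finset.sum_congr rfl fun i _ => ?_
  rw [val_smul, val_toRow, ← act_mul, map_mul, MulOpposite.unop_op]

/-- Row vectors over the corner as row vectors over `V`. -/
noncomputable def ofRow (w : ℕ →₀ Corner φ V) : ℕ →₀ V :=
  w.sum fun j x => act x.val (φ.symm (single 0 j 1))

/-- The sum of e_{j0} e_{0j} over j < n is a truncated identity, whose preimage under φ fixes v for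
suitable n. -/
theorem ofRow_toRow (v : ℕ →₀ V) : ofRow (toRow v : ℕ →₀ Corner φ V) = v := by
  obtain ⟨n, hn, hn'⟩ := exists_act_symm_trunc φ v
  rw [ofRow, Finsupp.sum_of_support_subset (s := Finset.range n) _ _ _ fun _ _ => zero_act _]
  · conv_rhs => rw [← hn, trunc, map_sum, act_sum]
    refine Finset.sum_congr rfl fun j _ => ?_
    rw [val_toRow, ← act_mul, ← map_mul, single_mul_single, mul_one]
  · intro j hj
    by_contra h
    exact Finsupp.mem_support_iff.mp hj
      (val_injective (hn' j (not_lt.mp fun hlt => h (Finset.mem_range.mpr hlt)) 0 1))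

/-- The product e_{0j} e_{k0} is e₀₀ for j = k and zero otherwise. -/
theorem toRow_ofRow (w : ℕ →₀ Corner φ V) : toRow (ofRow w) = w := by
  refine Finsupp.ext fun k => val_injective ?_
  rw [val_toRow, ofRow, Finsupp.sum, sum_act]
  simp only [← act_mul, ← map_mul]
  rw [Finset.sum_eq_single k]
  · rw [single_mul_single, mul_one, act_val]
  · intro j _ hj
    rw [single_mul_single_of_ne hj, map_zero, act_zero]
  · intro hk
    rw [Finsupp.notMem_support_iff.mp hk, val_zero, zero_act]

/-- Taking the corner twice, along an isomorphism and its inverse, gives back the module. -/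
noncomputable def cornerEquiv : V ≃ₗ[Aᵐᵒᵖ] Corner φ.symm (Corner φ V) where
  toFun x := ⟨toRow (Finsupp.single 0 x), by
    change act _ (φ _) = _
    rw [← toRow_act]
    congr 1
    ext k
    rw [act_single_apply]
    by_cases hk : k = 0 <;> simp [hk]⟩
  invFun w := ofRow w.val 0
  left_inv x := by
    change ofRow (toRow _) 0 = x
    rw [ofRow_toRow, Finsupp.single_eq_same]
  right_inv w := val_injective <| by
    change toRow (Finsupp.single 0 (ofRow w.val 0)) = w.val
    -- Keeping only entry 0 is the action of e₀₀, which `toRow` turns into the action of φ(e₀₀);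
    -- this fixes w by definition of the corner.
    have h1 : act (ofRow w.val) (single 0 0 (1 : A)) = Finsupp.single 0 (ofRow w.val 0) := by
      ext k
      rw [act_single_apply]
      by_cases hk : k = 0 <;> simp [hk]
    rw [← h1, toRow_act, toRow_ofRow]
    exact act_val w
  map_add' x y := val_injective <| by
    change toRow _ = toRow _ + toRow _
    rw [Finsupp.single_add, toRow_add]
  map_smul' a x := val_injective <| by
    change toRow (Finsupp.single 0 (a • x)) = act (toRow _) (φ (single 0 0 a.unop))
    rw [← toRow_act]
    congr 1
    ext k
    rw [act_single_apply]
    by_cases hk : k = 0 <;> simp [hk]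

theorem map_map_cornerEquiv (f : V →ₗ[Aᵐᵒᵖ] W) (x : V) :
    map (map f) (cornerEquiv (φ := φ) x) = cornerEquiv (φ := φ) (f x) := by
  refine val_injective (Finsupp.ext fun j => val_injective ?_)
  change Finsupp.mapRange.linearMap f (act (Finsupp.single 0 x) _) = act (Finsupp.single 0 (f x)) _
  rw [mapRange_act]
  simp

end Corner

end Corner

/-! ### The Morita equivalence -/

open CategoryTheory

/-- The functor between categories of right modules given by the corner. -/
noncomputable def cornerFunctor {A : Type u} {B : Type v} [Ring A] [Ring B]
    (φ : MInf A ≃+* MInf B) :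
    ModuleCat.{max u v} Aᵐᵒᵖ ⥤ ModuleCat.{max u v} Bᵐᵒᵖ where
  obj V := ModuleCat.of Bᵐᵒᵖ (Corner φ V)
  map f := ModuleCat.ofHom (Corner.map f.hom)
  map_id V := by
    ext v
    refine Corner.val_injective (Finsupp.ext fun j => rfl)
  map_comp f g := by
    ext v
    refine Corner.val_injective (Finsupp.ext fun j => rfl)

/-- The unit of the equivalence given by the corner functors. -/
noncomputable def cornerUnitIso {A : Type u} {B : Type v} [Ring A] [Ring B]
    (φ : MInf A ≃+* MInf B) :
    𝟭 (ModuleCat.{max u v} Aᵐᵒᵖ) ≅ cornerFunctor φ ⋙ cornerFunctor.{v, u} φ.symm :=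
  NatIso.ofComponents (fun V => (Corner.cornerEquiv (φ := φ) (V := V)).toModuleIso) fun f => by
    ext x
    exact (Corner.map_map_cornerEquiv f.hom x).symm

theorem moritaEquivalent {A : Type u} {B : Type v} [Ring A] [Ring B]
    (φ : MInf A ≃+* MInf B) : MoritaEquivalent A B :=
  -- The counit is the inverse of the unit for `φ.symm`, since `φ.symm.symm` is φ by definition.
  ⟨CategoryTheory.Equivalence.mk (cornerFunctor φ) (cornerFunctor.{v, u} φ.symm)
    (cornerUnitIso φ) (cornerUnitIso.{v, u} φ.symm).symm⟩

end MInf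

theorem mainTheorem7 (A : Type u) (B : Type v) [Ring A] [Ring B] :
    Nonempty (MInf A ≃+* MInf B) ↔ MoritaEquivalent A B :=
  ⟨fun ⟨φ⟩ => MInf.moritaEquivalent φ, fun h => h.nonempty_mInf_ringEquiv⟩
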